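/- There are a single random access machine program $P$ and constants $C,k\in\mathbb{N}$ such that the following holds for every $n$. Let $G=((A,B),E_G)$ be a connected bipartite graph with vertex set $\{0,\dots,n-1\}$ and with partite sets $A$ and $B$ (disjoint independent sets whose union is the vertex set), where $1\le |A|\le |B|$. Started on the adjacency matrix of $G$ together with $n$ and the indicator vector of $A$, the program $P$ halts after at most $C n^2$ steps, with answer "yes" if $\gamma(G)=|A|$ and with answer "no" otherwise; that is, whether $\gamma(G)=|A|$ can be decided in $O(n^2)$ time. Here $\gamma(G)$ is the domination number of $G$, the least cardinality of a set $D$ of vertices such that every vertex outside $D$ has a neighbour in $D$. The machine has natural-number registers and an indirectly addressed memory. One step is the execution of one instruction: loading a constant, addition, truncated subtraction or multiplication of registers, reading or writing a memory cell whose address is in a register, a jump, or a jump conditional on comparing two registers. In addition, every number held in a register or in a memory cell during the run is at most $n^k$, so that words of $O(\log n)$ bits suffice. All registers and memory cells not used for the input are initially $0$. -/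

import Mathlib

namespace SimpleGraph

/-- `D` is a dominating set of `G`: every vertex outside `D` has a neighbour in `D`. -/
def IsDominatingSet {V : Type*} (G : SimpleGraph V) (D : Finset V) : Prop :=
  ∀ v, v ∉ D → ∃ u ∈ D, G.Adj v u

/-- The domination number `γ(G)`: the least cardinality of a dominating set of a finite graph.
The infimum is over a nonempty set of natural numbers, as the set of all vertices dominates. -/
noncomputable def dominationNumber {V : Type*} [Fintype V] (G : SimpleGraph V) : ℕ :=
  sInf {k : ℕ | ∃ D : Finset V, G.IsDominatingSet D ∧ D.card = k}

end SimpleGraph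

/-! A random access machine with registers and an indirectly addressed memory. -/

namespace RAM

/-- Instructions. The arguments `r s t` are (fixed) register numbers, `l` is a position in the
program, and `v` is a constant. -/
inductive Instr : Type
  /-- `r := v` -/
  | const (r v : ℕ)
  /-- `r := s + t` -/
  | add (r s t : ℕ)
  /-- `r := s - t`, or `0` if `s < t` -/
  | sub (r s t : ℕ)
  /-- `r := s * t` -/
  | mul (r s t : ℕ)
  /-- `r := memory[s]` -/
  | load (r s : ℕ)
  /-- `memory[s] := r` -/
  | store (s r : ℕ)
  /-- go to `l` -/
  | jump (l : ℕ)
  /-- go to `l` if `s < t`, otherwise continue with the next instruction -/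
  | jumpLt (s t l : ℕ)
  /-- stop with the answer `b` -/
  | halt (b : Bool)

/-- A program is a finite list of instructions, numbered from `0`. -/
abbrev Program : Type := List Instr

/-- A configuration: the program counter, the registers and the memory. -/
structure Config where
  pc : ℕ
  reg : ℕ → ℕ
  mem : ℕ → ℕ

/-- Assign `v` to register `r` and continue with the next instruction. -/
def Config.assign (c : Config) (r v : ℕ) : Config :=
  ⟨c.pc + 1, Function.update c.reg r v, c.mem⟩

/-- The effect of one instruction. A halted machine stays where it is. -/
def Instr.exec (c : Config) : Instr → Config
  | .const r v => c.assign r v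
  | .add r s t => c.assign r (c.reg s + c.reg t)
  | .sub r s t => c.assign r (c.reg s - c.reg t)
  | .mul r s t => c.assign r (c.reg s * c.reg t)
  | .load r s => c.assign r (c.mem (c.reg s))
  | .store s r => ⟨c.pc + 1, c.reg, Function.update c.mem (c.reg s) (c.reg r)⟩
  | .jump l => ⟨l, c.reg, c.mem⟩
  | .jumpLt s t l => ⟨if c.reg s < c.reg t then l else c.pc + 1, c.reg, c.mem⟩
  | .halt _ => c

/-- One step of computation. Outside the program the machine is stuck, without an answer. -/
def step (P : Program) (c : Config) : Config :=
  match P[c.pc]? with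
  | some i => i.exec c
  | none => c

/-- The configuration after `t` steps. -/
def run (P : Program) (c : Config) (t : ℕ) : Config :=
  (step P)^[t] c

/-- Started from `c`, the program `P` stops with the answer `b` after at most `T` steps. -/
def HaltsWithin (P : Program) (c : Config) (T : ℕ) (b : Bool) : Prop :=
  ∃ t ≤ T, P[(run P c t).pc]? = some (Instr.halt b)

/-- All numbers that the machine ever holds when started from `c` are at most `N`. -/
def ValuesBoundedBy (P : Program) (c : Config) (N : ℕ) : Prop :=
  ∀ t i, (run P c t).reg i ≤ N ∧ (run P c t).mem i ≤ N

open Classical in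
/-- The initial configuration for a graph `G` with vertices `0, …, n - 1` and a set `A` of
vertices. Register `0` holds `n`; the memory holds the indicator vector of `A` in the cells
`0, …, n - 1`, followed by the rows of the adjacency matrix of `G`; everything else is `0`. -/
noncomputable def inputConfig {n : ℕ} (G : SimpleGraph (Fin n)) (A : Finset (Fin n)) : Config where
  pc := 0
  reg := fun r => if r = 0 then n else 0
  mem := fun a =>
    if (∃ i ∈ A, a = (i : ℕ)) ∨ (∃ i j : Fin n, G.Adj i j ∧ a = n + (i : ℕ) * n + (j : ℕ))
    then 1 else 0

end RAM

namespace RAM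

/-! ### Reasoning about runs -/

/-- All numbers held in the configuration `c` are at most `N`. -/
def Config.Bounded (N : ℕ) (c : Config) : Prop := ∀ i, c.reg i ≤ N ∧ c.mem i ≤ N

/-- Started from `c`, the program reaches after at most `T` steps a configuration satisfying `Q`,
and until then all numbers are at most `N`. -/
def Goes (P : Program) (N : ℕ) (c : Config) (T : ℕ) (Q : Config → Prop) : Prop :=
  ∃ t ≤ T, Q (run P c t) ∧ ∀ s ≤ t, (run P c s).Bounded N

theorem run_add (P : Program) (c : Config) (s t : ℕ) :
    run P c (s + t) = run P (run P c s) t := by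
  unfold run
  rw [add_comm, Function.iterate_add_apply]

theorem Goes.done {P : Program} {N : ℕ} {c : Config} {Q : Config → Prop} (T : ℕ)
    (hc : c.Bounded N) (hQ : Q c) : Goes P N c T Q := by
  refine ⟨0, Nat.zero_le _, hQ, fun s hs => ?_⟩
  obtain rfl : s = 0 := by omega
  exact hc

theorem Goes.bind {P : Program} {N T₁ T₂ : ℕ} {c : Config} {Q R : Config → Prop}
    (h₁ : Goes P N c T₁ Q) (h₂ : ∀ c', c'.Bounded N → Q c' → Goes P N c' T₂ R) :
    Goes P N c (T₁ + T₂) R := by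
  obtain ⟨t, ht, hQ, hb⟩ := h₁
  obtain ⟨u, hu, hR, hb'⟩ := h₂ _ (hb t le_rfl) hQ
  refine ⟨t + u, by omega, by rwa [run_add], fun s hs => ?_⟩
  rcases le_total s t with h | h
  · exact hb s h
  · obtain ⟨d, rfl⟩ := Nat.exists_eq_add_of_le h
    rw [run_add]
    exact hb' d (by omega)

theorem Goes.mono {P : Program} {N T T' : ℕ} {c : Config} {Q : Config → Prop}
    (h : Goes P N c T Q) (hT : T ≤ T') : Goes P N c T' Q := by
  obtain ⟨t, ht, h⟩ := h
  exact ⟨t, ht.trans hT, h⟩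

theorem Goes.exec {P : Program} {N T : ℕ} {c : Config} {Q : Config → Prop} {i : Instr}
    (hi : P[c.pc]? = some i) (hc : c.Bounded N) (h : Goes P N (i.exec c) T Q) :
    Goes P N c (1 + T) Q := by
  have hs : run P c 1 = i.exec c := by simp [run, step, hi]
  obtain ⟨t, ht, hQ, hb⟩ := h
  refine ⟨1 + t, by omega, by rwa [run_add, hs], fun s hs' => ?_⟩
  rcases s with _ | s
  · exact hc
  · rw [add_comm, run_add, hs]
    exact hb s (by omega)

theorem Config.Bounded.assign {N : ℕ} {c : Config} (hc : c.Bounded N) (r : ℕ) {x : ℕ}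
    (hx : x ≤ N) : (c.assign r x).Bounded N := by
  intro i
  refine ⟨?_, (hc i).2⟩
  simp only [Config.assign, Function.update_apply]
  split_ifs
  exacts [hx, (hc i).1]

/-- An assignment step. -/
theorem Goes.assign {P : Program} {N T : ℕ} {c : Config} {Q : Config → Prop} (i : Instr)
    (r x : ℕ) (hi : P[c.pc]? = some i) (hx : i.exec c = c.assign r x) (hc : c.Bounded N)
    (hN : x ≤ N) (h : (c.assign r x).Bounded N → Goes P N (c.assign r x) T Q) :
    Goes P N c (1 + T) Q :=
  Goes.exec hi hc (by rw [hx]; exact h (hc.assign r hN))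

/-- Repeating a block of code `m` times. -/
theorem Goes.iterate {P : Program} {N T : ℕ} (I : ℕ → Config → Prop) (m : ℕ)
    (h : ∀ j < m, ∀ c, c.Bounded N → I j c → Goes P N c T (I (j + 1))) {c : Config}
    (hc : c.Bounded N) (h0 : I 0 c) : Goes P N c (m * T) (I m) := by
  induction m with
  | zero => exact Goes.done _ hc h0
  | succ m ih =>
    rw [Nat.succ_mul]
    exact (ih fun j hj => h j (by omega)).bind fun c' hc' hI => h m (by omega) c' hc' hI

/-- The instructions `l` stand in the program `P` from position `p` on. -/
def CodeAt (P : Program) (p : ℕ) (l : List Instr) : Prop :=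
  ∀ i, i < l.length → P[p + i]? = l[i]?

theorem CodeAt.left {P : Program} {p : ℕ} {l₁ l₂ : List Instr} (h : CodeAt P p (l₁ ++ l₂)) :
    CodeAt P p l₁ := by
  intro i hi
  rw [h i (by simp; omega), List.getElem?_append_left hi]

theorem CodeAt.right {P : Program} {p : ℕ} {l₁ l₂ : List Instr} (h : CodeAt P p (l₁ ++ l₂)) :
    CodeAt P (p + l₁.length) l₂ := by
  intro i hi
  rw [add_assoc, h _ (by simp; omega), List.getElem?_append_right (by omega)]
  simp

theorem CodeAt.get {P : Program} {p : ℕ} {l : List Instr} (h : CodeAt P p l) (i : ℕ) {x : Instr}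
    (hx : l[i]? = some x) : P[p + i]? = some x := by
  rw [h i (List.getElem?_eq_some_iff.1 hx).1, hx]

/-! ### Expressions -/

/-- Arithmetical expressions in the size `n` of the input, a row index and a column index, with
access to the memory. -/
inductive Expr : Type
  | size
  | row
  | col
  | const (v : ℕ)
  | add (x y : Expr)
  | sub (x y : Expr)
  | mul (x y : Expr)
  | load (x : Expr)

namespace Expr

/-- The value of an expression. -/
def eval (n v w : ℕ) (m : ℕ → ℕ) : Expr → ℕ
  | size => n
  | row => v
  | col => w
  | const a => a
  | add x y => eval n v w m x + eval n v w m y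
  | sub x y => eval n v w m x - eval n v w m y
  | mul x y => eval n v w m x * eval n v w m y
  | load x => m (eval n v w m x)

/-- Code that writes the value of an expression into register `t`. The size, the row and the
column index are expected in the registers `0`, `2` and `3`. -/
def compile : Expr → ℕ → List Instr
  | size, t => [.const t 0, .add t t 0]
  | row, t => [.const t 0, .add t t 2]
  | col, t => [.const t 0, .add t t 3]
  | const a, t => [.const t a]
  -- The registers from `t` upwards act as a stack: the left operand rests in `t` while the right
  -- one is computed above it.
  | add x y, t => compile x t ++ (compile y (t + 1) ++ [.add t t (t + 1)])
  | sub x y, t => compile x t ++ (compile y (t + 1) ++ [.sub t t (t + 1)])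
  | mul x y, t => compile x t ++ (compile y (t + 1) ++ [.mul t t (t + 1)])
  | load x, t => compile x t ++ [.load t t]

/-- An exponent `k` such that the value of the expression is at most `n ^ k` if all numbers in
the memory are at most `n ^ a`. -/
def exponent (a : ℕ) : Expr → ℕ
  | size => 1
  | row => 1
  | col => 1
  | const v => v
  | add x y => exponent a x + exponent a y + 1
  | sub x y => exponent a x + exponent a y
  | mul x y => exponent a x + exponent a y
  | load x => exponent a x + a

/-- Base at least 2 lets the exponent absorb constants, by c ≤ 2 ^ c ≤ n ^ c, and the factor 2
caused by an addition. -/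
theorem eval_le {n v w a : ℕ} {m : ℕ → ℕ} (hn : 2 ≤ n) (hv : v < n) (hw : w < n)
    (hm : ∀ i, m i ≤ n ^ a) (e : Expr) : e.eval n v w m ≤ n ^ e.exponent a := by
  have mono : ∀ {p q : ℕ}, p ≤ q → n ^ p ≤ n ^ q := fun h => Nat.pow_le_pow_right (by omega) h
  induction e with
  | size => simp [eval, exponent]
  | row => simpa [eval, exponent] using hv.le
  | col => simpa [eval, exponent] using hw.le
  | const c =>
    exact (Nat.lt_two_pow_self (n := c)).le.trans (Nat.pow_le_pow_left hn c)
  | add x y hx hy =>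
    simp only [eval, exponent]
    have h₁ := hx.trans (mono (Nat.le_add_right (exponent a x) (exponent a y)))
    have h₂ := hy.trans (mono (Nat.le_add_left (exponent a y) (exponent a x)))
    rw [pow_succ]
    nlinarith
  | sub x y hx hy =>
    simp only [eval, exponent]
    exact (Nat.sub_le _ _).trans (hx.trans (mono (Nat.le_add_right _ _)))
  | mul x y hx hy =>
    simp only [eval, exponent, pow_add]
    exact Nat.mul_le_mul hx hy
  | load x hx => exact (hm _).trans (mono (Nat.le_add_left _ _))

variable {P : Program} {n v w a K : ℕ}

/-- The configuration `c'` results from `c` by writing `x` into register `t`, possibly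
overwriting higher registers, and moving forward by `d` instructions. -/
def Wrote (c : Config) (d t x : ℕ) (c' : Config) : Prop :=
  c'.pc = c.pc + d ∧ c'.mem = c.mem ∧ (∀ r < t, c'.reg r = c.reg r) ∧ c'.reg t = x

theorem goes_copy {N : ℕ} {c : Config} {t s : ℕ} (hs : s < t)
    (hP : CodeAt P c.pc [.const t 0, .add t t s]) (hc : c.Bounded N) :
    Goes P N c 2 (Wrote c 2 t (c.reg s)) := by
  refine Goes.assign (T := 1) _ t 0 (hP.get 0 rfl) rfl hc (Nat.zero_le _) fun h₁ => ?_
  refine Goes.assign (T := 0) (.add t t s) t (c.reg s) (hP.get 1 rfl) ?_ h₁ (hc s).1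
    fun h₂ => Goes.done _ h₂ ?_
  · simp [Instr.exec, Config.assign, hs.ne]
  · refine ⟨rfl, rfl, fun r hr => ?_, ?_⟩
    · simp [Config.assign, hr.ne]
    · simp [Config.assign]

theorem goes_binary {N : ℕ} {c : Config} {t x y z : ℕ} {l₁ l₂ : List Instr} {i : Instr}
    (hP : CodeAt P c.pc (l₁ ++ (l₂ ++ [i])))
    (h₁ : Goes P N c l₁.length (Wrote c l₁.length t x))
    (h₂ : ∀ c₁ : Config, c₁.Bounded N → Wrote c l₁.length t x c₁ →
      Goes P N c₁ l₂.length (Wrote c₁ l₂.length (t + 1) y))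
    (hi : ∀ c₂ : Config, c₂.reg t = x → c₂.reg (t + 1) = y → i.exec c₂ = c₂.assign t z)
    (hz : z ≤ N) :
    Goes P N c (l₁ ++ (l₂ ++ [i])).length (Wrote c (l₁ ++ (l₂ ++ [i])).length t z) := by
  rw [List.length_append]
  refine h₁.bind fun c₁ hc₁ w₁ => ?_
  rw [List.length_append]
  refine (h₂ c₁ hc₁ w₁).bind fun c₂ hc₂ w₂ => ?_
  obtain ⟨p₁, m₁, r₁, x₁⟩ := w₁
  obtain ⟨p₂, m₂, r₂, x₂⟩ := w₂
  have hpc := hP.right.right.get 0 rfl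
  rw [add_zero, ← p₁, ← p₂] at hpc
  refine Goes.assign (T := 0) i t z hpc (hi c₂ ?_ x₂) hc₂ hz fun h => Goes.done _ h ?_
  · rw [r₂ t (by omega), x₁]
  · refine ⟨?_, ?_, fun r hr => ?_, ?_⟩
    · simp [Config.assign, p₁, p₂]; omega
    · simp [Config.assign, m₁, m₂]
    · rw [← r₁ r hr, ← r₂ r (by omega)]
      simp [Config.assign, hr.ne]
    · simp [Config.assign]

/-- The code is straight-line, so its length bounds the time; `6 ≤ t` protects the loop registers.
The memory has its own bound `n ^ a`, because bounding loaded values only by `n ^ K` would not keep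
later results below `n ^ K`. -/
theorem goes_compile (hn : 2 ≤ n) (hv : v < n) (hw : w < n) (e : Expr) (he : e.exponent a ≤ K) :
    ∀ (t : ℕ) (c : Config), 6 ≤ t → CodeAt P c.pc (e.compile t) → c.Bounded (n ^ K) →
      c.reg 0 = n → c.reg 2 = v → c.reg 3 = w → (∀ i, c.mem i ≤ n ^ a) →
      Goes P (n ^ K) c (e.compile t).length
        (Wrote c (e.compile t).length t (e.eval n v w c.mem)) := by
  have hK : ∀ (e : Expr) (m : ℕ → ℕ), (∀ i, m i ≤ n ^ a) → e.exponent a ≤ K →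
      e.eval n v w m ≤ n ^ K := fun e m hm he =>
    (eval_le hn hv hw hm e).trans (Nat.pow_le_pow_right (by omega) he)
  -- Addition, subtraction and multiplication are handled at once; the last two assumptions are the
  -- induction hypotheses.
  have key : ∀ (x y : Expr) (f : ℕ → ℕ → ℕ) (i : ℕ → Instr), x.exponent a ≤ K →
      y.exponent a ≤ K →
      (∀ m : ℕ → ℕ, (∀ i, m i ≤ n ^ a) → f (x.eval n v w m) (y.eval n v w m) ≤ n ^ K) →
      (∀ t c, (i t).exec c = c.assign t (f (c.reg t) (c.reg (t + 1)))) →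
      (∀ (t : ℕ) (c : Config), 6 ≤ t → CodeAt P c.pc (x.compile t) → c.Bounded (n ^ K) →
      c.reg 0 = n → c.reg 2 = v → c.reg 3 = w → (∀ i, c.mem i ≤ n ^ a) →
      Goes P (n ^ K) c (x.compile t).length
        (Wrote c (x.compile t).length t (x.eval n v w c.mem))) →
      (∀ (t : ℕ) (c : Config), 6 ≤ t → CodeAt P c.pc (y.compile t) → c.Bounded (n ^ K) →
      c.reg 0 = n → c.reg 2 = v → c.reg 3 = w → (∀ i, c.mem i ≤ n ^ a) →
      Goes P (n ^ K) c (y.compile t).length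
        (Wrote c (y.compile t).length t (y.eval n v w c.mem))) →
      ∀ (t : ℕ) (c : Config), 6 ≤ t →
      CodeAt P c.pc (x.compile t ++ (y.compile (t + 1) ++ [i t])) → c.Bounded (n ^ K) →
      c.reg 0 = n → c.reg 2 = v → c.reg 3 = w → (∀ i, c.mem i ≤ n ^ a) →
      Goes P (n ^ K) c (x.compile t ++ (y.compile (t + 1) ++ [i t])).length
        (Wrote c (x.compile t ++ (y.compile (t + 1) ++ [i t])).length t
          (f (x.eval n v w c.mem) (y.eval n v w c.mem))) := by
    intro x y f i ex ey hf hi hx hy t c ht hP hc h0 h2 h3 hm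
    refine goes_binary hP (hx t c ht hP.left hc h0 h2 h3 hm) (fun c₁ hc₁ w₁ => ?_)
      (fun c₂ e₁ e₂ => by rw [hi, e₁, e₂]) (hf _ hm)
    obtain ⟨p₁, m₁, r₁, x₁⟩ := w₁
    rw [← m₁]
    refine hy (t + 1) c₁ (by omega) ?_ hc₁ ?_ ?_ ?_ ?_
    · rw [p₁]; exact hP.right.left
    · rw [r₁ 0 (by omega), h0]
    · rw [r₁ 2 (by omega), h2]
    · rw [r₁ 3 (by omega), h3]
    · rwa [m₁]
  induction e with
  | size =>
    intro t c ht hP hc h0 h2 h3 hm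
    have := goes_copy (by omega) hP hc
    rwa [h0] at this
  | row =>
    intro t c ht hP hc h0 h2 h3 hm
    have := goes_copy (by omega) hP hc
    rwa [h2] at this
  | col =>
    intro t c ht hP hc h0 h2 h3 hm
    have := goes_copy (by omega) hP hc
    rwa [h3] at this
  | const b =>
    intro t c ht hP hc h0 h2 h3 hm
    refine Goes.assign (T := 0) _ t b (hP.get 0 rfl) rfl hc (hK (.const b) c.mem hm he)
      fun h => Goes.done _ h ⟨rfl, rfl, fun r hr => ?_, ?_⟩
    · simp [Config.assign, hr.ne]
    · simp [Config.assign, eval]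
  | add x y hx hy =>
    have he' : x.exponent a + y.exponent a + 1 ≤ K := he
    exact key x y (· + ·) (fun t => .add t t (t + 1)) (by omega) (by omega)
      (fun m hm => hK (.add x y) m hm he) (fun _ _ => rfl) (hx (by omega)) (hy (by omega))
  | sub x y hx hy =>
    have he' : x.exponent a + y.exponent a ≤ K := he
    exact key x y (· - ·) (fun t => .sub t t (t + 1)) (by omega) (by omega)
      (fun m hm => hK (.sub x y) m hm he) (fun _ _ => rfl) (hx (by omega)) (hy (by omega))
  | mul x y hx hy =>
    have he' : x.exponent a + y.exponent a ≤ K := he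
    exact key x y (· * ·) (fun t => .mul t t (t + 1)) (by omega) (by omega)
      (fun m hm => hK (.mul x y) m hm he) (fun _ _ => rfl) (hx (by omega)) (hy (by omega))
  | load x hx =>
    have he' : x.exponent a + a ≤ K := he
    intro t c ht hP hc h0 h2 h3 hm
    change Goes P _ c (x.compile t ++ [Instr.load t t]).length
      (Wrote c (x.compile t ++ [Instr.load t t]).length t (c.mem (x.eval n v w c.mem)))
    rw [List.length_append]
    refine (hx (by omega) t c ht hP.left hc h0 h2 h3 hm).bind fun c₁ hc₁ w₁ => ?_
    obtain ⟨p₁, m₁, r₁, x₁⟩ := w₁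
    have hpc := hP.right.get 0 rfl
    rw [add_zero, ← p₁] at hpc
    refine Goes.assign (T := 0) _ t (c.mem (x.eval n v w c.mem)) hpc ?_ hc₁ ?_
      fun h => Goes.done _ h ⟨?_, ?_, fun r hr => ?_, ?_⟩
    · simp [Instr.exec, x₁, m₁]
    · exact hK (.load x) c.mem hm he
    · simp [Config.assign, p₁]; omega
    · simp [Config.assign, m₁]
    · rw [← r₁ r hr]
      simp [Config.assign, hr.ne]
    · simp [Config.assign]

end Expr
end RAM

namespace RAM

open Finset

/-! ### Phases: filling arrays with sums -/

/-- Code, to be placed at position `p`, that appends to the memory an array whose entry with index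
`v` is the sum of the values of `e` over all columns in row `v`. Register `1` holds the number
`1`, register `4` the partial sum, and register `5` the address of the next entry. -/
def phase (e : Expr) (p : ℕ) : List Instr :=
  [.const 2 0, .const 4 0, .const 3 0] ++ (e.compile 6 ++
    [.add 4 4 6, .add 3 3 1, .jumpLt 3 0 (p + 3), .store 5 4, .add 5 5 1, .add 2 2 1,
      .jumpLt 2 0 (p + 1)])

theorem length_phase (e : Expr) (p : ℕ) : (phase e p).length = (e.compile 6).length + 10 := by
  simp [phase]

variable {P : Program} {n a K p : ℕ} {e : Expr}

theorem sum_range_eval_le (hn : 2 ≤ n) {v j : ℕ} (hv : v < n) (hj : j ≤ n)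
    (he : e.exponent a + 1 ≤ K) {m : ℕ → ℕ} (hm : ∀ i, m i ≤ n ^ a) :
    ∑ w ∈ range j, e.eval n v w m ≤ n ^ K :=
  calc ∑ w ∈ range j, e.eval n v w m ≤ ∑ w ∈ range j, n ^ e.exponent a :=
        sum_le_sum fun w hw =>
          Expr.eval_le hn hv ((mem_range.1 hw).trans_le hj) hm e
    _ = j * n ^ e.exponent a := by simp
    _ ≤ n * n ^ e.exponent a := Nat.mul_le_mul_right _ hj
    _ = n ^ (e.exponent a + 1) := by rw [pow_succ, mul_comm]
    _ ≤ n ^ K := Nat.pow_le_pow_right (by omega) he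

theorem goes_sum (hn : 2 ≤ n) (hP : CodeAt P p (phase e p)) (he : e.exponent a + 1 ≤ K)
    (hK : n ≤ n ^ K) {v : ℕ} (hv : v < n) {c : Config} (hc : c.Bounded (n ^ K))
    (hpc : c.pc = p + 3) (h0 : c.reg 0 = n) (h1 : c.reg 1 = 1) (h2 : c.reg 2 = v)
    (h3 : c.reg 3 = 0) (h4 : c.reg 4 = 0) (hm : ∀ i, c.mem i ≤ n ^ a) :
    Goes P (n ^ K) c (n * ((e.compile 6).length + 3)) fun c' =>
      c'.pc = p + (e.compile 6).length + 6 ∧ c'.reg 0 = n ∧ c'.reg 1 = 1 ∧ c'.reg 2 = v ∧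
      c'.reg 4 = ∑ w ∈ range n, e.eval n v w c.mem ∧ c'.reg 5 = c.reg 5 ∧ c'.mem = c.mem := by
  have hP1 : CodeAt P (p + 3) (e.compile 6) := hP.right.left
  have hP2 := hP.right.right
  simp only [List.length_cons, List.length_nil] at hP2
  -- The test stands at the end of the loop body, so after `j` rounds control is back at the loop
  -- head if `j < n` and past the loop otherwise.
  let I : ℕ → Config → Prop := fun j c' =>
    c'.pc = (if j < n then p + 3 else p + (e.compile 6).length + 6) ∧ c'.reg 0 = n ∧
    c'.reg 1 = 1 ∧ c'.reg 2 = v ∧ c'.reg 3 = j ∧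
    c'.reg 4 = ∑ w ∈ range j, e.eval n v w c.mem ∧ c'.reg 5 = c.reg 5 ∧ c'.mem = c.mem
  have key := Goes.iterate (P := P) (N := n ^ K) (T := (e.compile 6).length + 3) I n ?_ hc
    ⟨by rw [if_pos (by omega), hpc], h0, h1, h2, h3, by simpa using h4, rfl, rfl⟩
  · obtain ⟨t, ht, ⟨q1, q2, q3, q4, q5, q6, q7, q8⟩, hb⟩ := key
    exact ⟨t, ht, ⟨by simpa using q1, q2, q3, q4, q6, q7, q8⟩, hb⟩
  intro j hj c₁ hc₁ ⟨q1, q2, q3, q4, q5, q6, q7, q8⟩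
  rw [if_pos hj] at q1
  refine (Expr.goes_compile (a := a) hn hv hj e (by omega) 6 c₁ le_rfl (by rwa [q1]) hc₁ q2 q4 q5
    (by rwa [q8])).bind fun c₂ hc₂ ⟨w1, w2, w3, w4⟩ => ?_
  have hpc : c₂.pc = p + 3 + (e.compile 6).length := by rw [w1, q1]
  have hs := sum_range_eval_le (e := e) hn hv (show j + 1 ≤ n from hj) he hm
  rw [sum_range_succ] at hs
  refine Goes.assign (T := 2) (.add 4 4 6) 4 (∑ w ∈ range j, e.eval n v w c.mem + e.eval n v j c.mem)
    ?_ ?_ hc₂ hs fun hc₃ => ?_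
  · rw [hpc]; exact hP2.get 0 rfl
  · simp [Instr.exec, w3, w4, q6, q8]
  refine Goes.assign (T := 1) (.add 3 3 1) 3 (j + 1) ?_ ?_ hc₃ (by omega) fun hc₄ => ?_
  · simp only [Config.assign, hpc]; exact hP2.get 1 rfl
  · simp [Instr.exec, Config.assign, w3, q3, q5]
  refine Goes.exec (T := 0) (i := .jumpLt 3 0 (p + 3)) ?_ hc₄ (Goes.done _ hc₄ ?_)
  · simp only [Config.assign, hpc]; exact hP2.get 2 rfl
  · simp only [I, Instr.exec, Config.assign, hpc]
    refine ⟨?_, ?_, ?_, ?_, ?_, ?_, ?_, ?_⟩ <;>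
      simp [w2, w3, q2, q3, q4, q7, q8, sum_range_succ]
    split_ifs <;> omega

theorem goes_entry (hn : 2 ≤ n) (hP : CodeAt P p (phase e p)) (he : e.exponent a + 1 ≤ K)
    (hK : n ≤ n ^ K) {v : ℕ} (hv : v < n) {c : Config} (hc : c.Bounded (n ^ K))
    (hpc : c.pc = p + 1) (h0 : c.reg 0 = n) (h1 : c.reg 1 = 1) (h2 : c.reg 2 = v)
    (h5 : c.reg 5 + 1 ≤ n ^ K) (hm : ∀ i, c.mem i ≤ n ^ a) :
    Goes P (n ^ K) c (n * ((e.compile 6).length + 3) + 6) fun c' =>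
      c'.pc = (if v + 1 < n then p + 1 else p + (e.compile 6).length + 10) ∧ c'.reg 0 = n ∧
      c'.reg 1 = 1 ∧ c'.reg 2 = v + 1 ∧ c'.reg 5 = c.reg 5 + 1 ∧
      c'.reg 4 = ∑ w ∈ range n, e.eval n v w c.mem ∧
      c'.mem = Function.update c.mem (c.reg 5) (∑ w ∈ range n, e.eval n v w c.mem) := by
  have hP0 := hP.left
  have hP2 := hP.right.right
  simp only [List.length_cons, List.length_nil] at hP2
  refine Goes.mono (T := 1 + (1 + (n * ((e.compile 6).length + 3) + 4))) ?_ (by omega)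
  refine Goes.assign (.const 4 0) 4 0 ?_ rfl hc (Nat.zero_le _) fun hc₁ => ?_
  · rw [hpc]; exact hP0.get 1 rfl
  refine Goes.assign (.const 3 0) 3 0 ?_ rfl hc₁ (Nat.zero_le _) fun hc₂ => ?_
  · simp only [Config.assign, hpc]; exact hP0.get 2 rfl
  refine (goes_sum (a := a) hn hP he hK hv hc₂ ?_ ?_ ?_ ?_ ?_ ?_ ?_).bind
    fun c₃ hc₃ ⟨q1, q2, q3, q4, q5, q6, q7⟩ => ?_
  · simp [Config.assign, hpc]
  · simpa [Config.assign] using h0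
  · simpa [Config.assign] using h1
  · simpa [Config.assign] using h2
  · simp [Config.assign]
  · simp [Config.assign]
  · simpa [Config.assign] using hm
  have q5' : c₃.reg 4 = ∑ w ∈ range n, e.eval n v w c.mem := q5
  have q6' : c₃.reg 5 = c.reg 5 := by simpa [Config.assign] using q6
  have q7' : c₃.mem = c.mem := q7
  clear q5 q6 q7
  have hs := sum_range_eval_le (e := e) hn hv le_rfl he hm
  have hc₄ : ((Instr.store 5 4).exec c₃).Bounded (n ^ K) := by
    intro i
    refine ⟨(hc₃ i).1, ?_⟩
    simp only [Instr.exec, Function.update_apply]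
    split_ifs
    exacts [q5' ▸ hs, (hc₃ i).2]
  refine Goes.exec (T := 3) (i := .store 5 4) ?_ hc₃ ?_
  · rw [q1, show p + (e.compile 6).length + 6 = p + (0 + 1 + 1 + 1) + (e.compile 6).length + 3 by
      omega]
    exact hP2.get 3 rfl
  refine Goes.assign (T := 2) (.add 5 5 1) 5 (c.reg 5 + 1) ?_ ?_ hc₄ h5 fun hc₅ => ?_
  · simp only [Instr.exec, q1]
    rw [show p + (e.compile 6).length + 6 + 1 =
      p + (0 + 1 + 1 + 1) + (e.compile 6).length + 4 by omega]
    exact hP2.get 4 rfl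
  · simp [Instr.exec, q6', q3]
  refine Goes.assign (T := 1) (.add 2 2 1) 2 (v + 1) ?_ ?_ hc₅ (by omega) fun hc₆ => ?_
  · simp only [Instr.exec, Config.assign, q1]
    rw [show p + (e.compile 6).length + 6 + 1 + 1 =
      p + (0 + 1 + 1 + 1) + (e.compile 6).length + 5 by omega]
    exact hP2.get 5 rfl
  · simp [Instr.exec, Config.assign, q3, q4]
  refine Goes.exec (T := 0) (i := .jumpLt 2 0 (p + 1)) ?_ hc₆ (Goes.done _ hc₆ ?_)
  · simp only [Instr.exec, Config.assign, q1]
    rw [show p + (e.compile 6).length + 6 + 1 + 1 + 1 =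
      p + (0 + 1 + 1 + 1) + (e.compile 6).length + 6 by omega]
    exact hP2.get 6 rfl
  · simp only [Instr.exec, Config.assign, q1]
    refine ⟨?_, ?_, ?_, ?_, ?_, ?_, ?_⟩ <;> simp [q2, q3, q5', q6', q7']

/-- The memory `m` holds the input `m₀`, followed by the arrays `f 0, …, f (k - 1)`. -/
def Filled (n : ℕ) (m₀ : ℕ → ℕ) (f : ℕ → Fin n → ℕ) (k : ℕ) (m : ℕ → ℕ) : Prop :=
  (∀ i < n + n * n, m i = m₀ i) ∧ ∀ j < k, ∀ v : Fin n, m (n + n * n + j * n + v) = f j v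

theorem Filled.update {m₀ : ℕ → ℕ} {f : ℕ → Fin n → ℕ} {k : ℕ} {m : ℕ → ℕ}
    (h : Filled n m₀ f k m) {i : ℕ} (hi : n + n * n + k * n ≤ i) (x : ℕ) :
    Filled n m₀ f k (Function.update m i x) := by
  refine ⟨fun j hj => ?_, fun j hj v => ?_⟩
  · rw [Function.update_of_ne (by omega), h.1 j hj]
  · have : j * n + n ≤ k * n := by
      rw [← Nat.succ_mul]; exact Nat.mul_le_mul_right _ hj
    rw [Function.update_of_ne (by omega), h.2 j hj]

/-- The machine stands at the instruction `p`, with the first `k` arrays filled. -/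
structure Ready (n : ℕ) (m₀ : ℕ → ℕ) (f : ℕ → Fin n → ℕ) (a k p : ℕ) (c : Config) : Prop where
  pc_eq : c.pc = p
  reg_size : c.reg 0 = n
  reg_one : c.reg 1 = 1
  reg_pointer : c.reg 5 = n + n * n + k * n
  mem_le : ∀ i, c.mem i ≤ n ^ a
  filled : Filled n m₀ f k c.mem

/-- `hf` concerns every memory with `k` filled arrays, since the memory changes with each finished
row: the row sums must not depend on the partly written array `k`. -/
theorem goes_phase {m₀ : ℕ → ℕ} {f : ℕ → Fin n → ℕ} {k : ℕ} (hn : 2 ≤ n)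
    (hP : CodeAt P p (phase e p)) (he : e.exponent a + 1 ≤ K)
    (hK : n + n * n + (k + 1) * n ≤ n ^ K)
    (hf : ∀ m, Filled n m₀ f k m → ∀ v : Fin n, ∑ w : Fin n, e.eval n v w m = f k v)
    (hfa : ∀ v, f k v ≤ n ^ a) {c : Config} (hc : c.Bounded (n ^ K))
    (h : Ready n m₀ f a k p c) :
    Goes P (n ^ K) c (n ^ 2 * ((e.compile 6).length + 10)) fun c' =>
      Ready n m₀ f a (k + 1) (p + (phase e p).length) c' ∧
      c'.reg 4 = f k ⟨n - 1, by omega⟩ := by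
  have hn1 : 1 ≤ n ^ 2 := Nat.one_le_pow _ _ (by omega)
  refine Goes.mono (T := 1 + n * (n * ((e.compile 6).length + 3) + 6)) ?_
    (by rw [pow_two] at *; nlinarith)
  have hk : (k + 1) * n = k * n + n := Nat.succ_mul _ _
  -- The last clause keeps the sum of the row just finished, so that register `4` ends with the last
  -- entry of the array, which the final test of the program inspects.
  let I : ℕ → Config → Prop := fun v c' =>
    c'.pc = (if v < n then p + 1 else p + (e.compile 6).length + 10) ∧ c'.reg 0 = n ∧
    c'.reg 1 = 1 ∧ c'.reg 2 = v ∧ c'.reg 5 = n + n * n + k * n + v ∧ (∀ i, c'.mem i ≤ n ^ a) ∧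
    Filled n m₀ f k c'.mem ∧ (∀ u : Fin n, (u : ℕ) < v →
      c'.mem (n + n * n + k * n + u) = f k u) ∧
    ∀ u : Fin n, (u : ℕ) + 1 = v → c'.reg 4 = f k u
  refine Goes.assign (.const 2 0) 2 0 ?_ rfl hc (Nat.zero_le _) fun hc₁ => ?_
  · rw [h.pc_eq]; exact hP.left.get 0 rfl
  have key := Goes.iterate (P := P) (N := n ^ K) (T := n * ((e.compile 6).length + 3) + 6) I n ?_
    hc₁ ?_
  · obtain ⟨t, ht, ⟨q1, q2, q3, q4, q5, q6, q7, q8, q9⟩, hb⟩ := key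
    refine ⟨t, ht, ⟨⟨?_, q2, q3, by omega, q6, q7.1, fun j hj v => ?_⟩, q9 _ ?_⟩, hb⟩
    · rw [q1, length_phase]; simp; omega
    · rcases Nat.lt_succ_iff_lt_or_eq.1 hj with hj | rfl
      · exact q7.2 j hj v
      · exact q8 v v.2
    · simp only; omega
  · intro v hv c₂ hc₂ ⟨q1, q2, q3, q4, q5, q6, q7, q8, q9⟩
    rw [if_pos hv] at q1
    obtain ⟨t, ht, ⟨w1, w2, w3, w4, w5, w6, w7⟩, hb⟩ :=
      goes_entry (a := a) hn hP he (by omega) hv hc₂ q1 q2 q3 q4 (by omega) q6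
    have hs : ∑ w ∈ range n, e.eval n v w c₂.mem = f k ⟨v, hv⟩ := by
      rw [sum_range, ← hf _ q7]
    rw [hs] at w6 w7
    rw [q5] at w5 w7
    refine ⟨t, ht, ⟨w1, w2, w3, w4, by omega, fun i => ?_, ?_, fun u hu => ?_, fun u hu => ?_⟩, hb⟩
    · rw [w7, Function.update_apply]
      split_ifs
      exacts [hfa _, q6 i]
    · rw [w7]
      exact q7.update (by omega) _
    · rw [w7]
      rcases Nat.lt_succ_iff_lt_or_eq.1 hu with hu | hu
      · rw [Function.update_of_ne (by omega), q8 u hu]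
      · rw [hu, Function.update_self, ← Fin.ext (a := u) (b := ⟨v, hv⟩) hu]
    · rw [w6, ← Fin.ext (a := u) (b := ⟨v, hv⟩) (by simpa using hu)]
  · refine ⟨?_, ?_, ?_, ?_, ?_, h.mem_le, h.filled, ?_, ?_⟩
    · rw [if_pos (by omega)]; simp [Config.assign, h.pc_eq]
    · simpa [Config.assign] using h.reg_size
    · simpa [Config.assign] using h.reg_one
    · simp [Config.assign]
    · simpa [Config.assign] using h.reg_pointer
    · simp
    · simp

/-- Code for a sequence of phases, to be placed at position `p`. -/
def phases : List Expr → ℕ → List Instr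
  | [], _ => []
  | e :: es, p => phase e p ++ phases es (p + (phase e p).length)

theorem goes_phases {m₀ : ℕ → ℕ} {f : ℕ → Fin n → ℕ} (hn : 2 ≤ n) (es : List Expr) :
    ∀ (k p : ℕ) (c : Config), CodeAt P p (phases es p) →
    (∀ e ∈ es, e.exponent a + 1 ≤ K) → n + n * n + (k + es.length) * n ≤ n ^ K →
    (∀ j, (hj : j < es.length) → ∀ m, Filled n m₀ f (k + j) m → ∀ v : Fin n,
      ∑ w : Fin n, es[j].eval n v w m = f (k + j) v) →
    (∀ j v, f j v ≤ n ^ a) → c.Bounded (n ^ K) → Ready n m₀ f a k p c →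
    Goes P (n ^ K) c (n ^ 2 * (phases es p).length) fun c' =>
      c'.pc = p + (phases es p).length ∧ c'.reg 1 = 1 ∧
      (∀ j, j + 1 = es.length → c'.reg 4 = f (k + j) ⟨n - 1, by omega⟩) := by
  induction es with
  | nil =>
    intro k p c hP he hK hf hfa hc h
    exact Goes.done _ hc ⟨by simpa [phases] using h.pc_eq, h.reg_one, by simp⟩
  | cons e es ih =>
    intro k p c hP he hK hf hfa hc h
    simp only [phases, List.length_append, mul_add, List.length_cons] at hP hK ⊢
    have hP' := hP.right
    have h₁ := goes_phase hn hP.left (he e (by simp))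
      ((Nat.add_le_add_left (Nat.mul_le_mul_right n (by omega)) _).trans hK)
      (fun m hm => hf 0 (by simp) m hm) (hfa k) hc h
    rw [← length_phase e p] at h₁
    refine h₁.bind fun c' hc' ⟨hr, h4⟩ => ?_
    obtain ⟨t, ht, ⟨q1, q2, q3⟩, hb⟩ := ih (k + 1) _ c' hP' (fun e' h' => he e' (by simp [h']))
      (by rw [add_assoc k 1, add_comm 1]; exact hK)
      (fun j hj m hm => by
        have := hf (j + 1) (by simpa using hj) m
        rw [show k + (j + 1) = k + 1 + j by omega] at this
        exact this hm) hfa hc' hr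
    refine ⟨t, ht, ⟨by rw [q1, add_assoc], q2, fun j hj => ?_⟩, hb⟩
    rcases es with _ | ⟨e', es⟩
    -- With no phase left there is no code to run, so register `4` is still as the current phase
    -- left it.
    · obtain rfl : t = 0 := by simpa [phases] using ht
      obtain rfl : j = 0 := by simpa using hj
      exact h4
    · obtain ⟨i, rfl⟩ : ∃ i, j = i + 1 := ⟨j - 1, by simp at hj; omega⟩
      rw [q3 i (by omega), show k + 1 + i = k + (i + 1) by omega]

/-- The complete program: fill the arrays given by `es`, and answer whether the last entry of the
last array is zero. -/
def program (es : List Expr) : Program :=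
  [.const 1 1, .mul 5 0 0, .add 5 5 0] ++ (phases es 3 ++
    [.jumpLt 4 1 (3 + (phases es 3).length + 2), .halt false, .halt true])

/-- A halted configuration is a fixed point, so bounds valid up to halting hold at all times. -/
theorem run_of_halt {c : Config} {t s : ℕ} {b : Bool}
    (h : P[(run P c t).pc]? = some (.halt b)) (hs : t ≤ s) : run P c s = run P c t := by
  induction s, hs using Nat.le_induction with
  | base => rfl
  | succ s _ ih =>
    rw [run_add, ih]
    simp [run, step, Instr.exec] at h ⊢
    rw [h]

theorem Goes.haltsWithin {N T : ℕ} {c : Config} {b : Bool}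
    (h : Goes P N c T fun c' => P[c'.pc]? = some (.halt b)) :
    HaltsWithin P c T b ∧ ValuesBoundedBy P c N := by
  obtain ⟨t, ht, hQ, hb⟩ := h
  refine ⟨⟨t, ht, hQ⟩, fun s i => ?_⟩
  rcases le_total s t with h | h
  · exact hb s h i
  · rw [run_of_halt hQ h]
    exact hb t le_rfl i

/-- An exponent for the bound on all numbers during the run of `program es`. -/
def totalExponent (a : ℕ) (es : List Expr) : ℕ :=
  (es.map fun e => e.exponent a + 1).sum + (es.length + 4)

theorem program_spec {m₀ : ℕ → ℕ} {f : ℕ → Fin n → ℕ} (hn : 2 ≤ n) (es : List Expr) (l : ℕ)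
    (hl : l + 1 = es.length)
    (hf : ∀ j, (hj : j < es.length) → ∀ m, Filled n m₀ f j m → ∀ v : Fin n,
      ∑ w : Fin n, es[j].eval n v w m = f j v)
    (hfa : ∀ j v, f j v ≤ n ^ a) (hm₀ : ∀ i, m₀ i ≤ 1) {c : Config} (hpc : c.pc = 0)
    (hreg : ∀ r, c.reg r = if r = 0 then n else 0) (hmem : c.mem = m₀) :
    HaltsWithin (program es) c (((phases es 3).length + 4) * n ^ 2)
        (decide (f l ⟨n - 1, by omega⟩ = 0)) ∧
      ValuesBoundedBy (program es) c (n ^ totalExponent a es) := by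
  have hn1 : 1 ≤ n ^ 2 := Nat.one_le_pow _ _ (by omega)
  -- This bounds the addresses in use, and is the source of the summand `es.length + 4` in
  -- `totalExponent`.
  have hle : n + n * n + (0 + es.length) * n ≤ (2 + es.length) * n ^ 2 := by
    have h₁ : n ≤ n * n := Nat.le_mul_self n
    have h₂ := Nat.mul_le_mul_left es.length h₁
    rw [zero_add, add_mul, pow_two]
    omega
  have hK : n + n * n + (0 + es.length) * n ≤ n ^ totalExponent a es :=
    calc n + n * n + (0 + es.length) * n ≤ (2 + es.length) * n ^ 2 := hle
      _ ≤ n ^ (2 + es.length) * n ^ 2 := Nat.mul_le_mul_right _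
          ((Nat.lt_two_pow_self).le.trans (Nat.pow_le_pow_left hn _))
      _ = n ^ (es.length + 4) := by rw [← pow_add]; congr 1; omega
      _ ≤ _ := Nat.pow_le_pow_right (by omega) (by simp [totalExponent])
  have hc : c.Bounded (n ^ totalExponent a es) := by
    intro i
    rw [hreg, hmem]
    refine ⟨?_, (hm₀ i).trans (Nat.one_le_pow _ _ (by omega))⟩
    split_ifs <;> omega
  have hP : CodeAt (program es) 0 (program es) := fun i _ => by rw [zero_add]
  have hP' : CodeAt (program es) 3 _ := hP.right
  have hP'' := hP'.right
  -- Three initial instructions and the final comparison account for the `4` in the time bound.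
  refine Goes.haltsWithin (Goes.mono (T := 1 + (1 + (1 + (n ^ 2 * (phases es 3).length + 1)))) ?_
    (by nlinarith))
  refine Goes.assign (.const 1 1) 1 1 ?_ rfl hc (by omega) fun hc₁ => ?_
  · rw [hpc]; exact hP.left.get 0 rfl
  refine Goes.assign (.mul 5 0 0) 5 (n * n) ?_ ?_ hc₁ (by omega) fun hc₂ => ?_
  · simp only [Config.assign, hpc]; exact hP.left.get 1 rfl
  · simp [Instr.exec, Config.assign, hreg]
  refine Goes.assign (.add 5 5 0) 5 (n + n * n) ?_ ?_ hc₂ (by omega) fun hc₃ => ?_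
  · simp only [Config.assign, hpc]; exact hP.left.get 2 rfl
  · simp [Instr.exec, Config.assign, hreg, add_comm]
  refine (goes_phases (a := a) (f := f) (m₀ := m₀) hn es 0 3 _ hP'.left (fun e he => ?_) hK
    (by simpa using hf) hfa hc₃ ⟨?_, ?_, ?_, ?_, ?_, ?_, ?_⟩).bind fun c' hc' ⟨q1, q2, q3⟩ => ?_
  · have := List.single_le_sum (l := es.map fun e => e.exponent a + 1) (by simp) _
      (List.mem_map_of_mem he)
    simp only [totalExponent]
    omega
  · simp [Config.assign, hpc]
  · simp [Config.assign, hreg]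
  · simp [Config.assign]
  · simp [Config.assign]
  · simp only [Config.assign, hmem]
    exact fun i => (hm₀ i).trans (Nat.one_le_pow _ _ (by omega))
  · simp [Config.assign, hmem]
  · simp
  · have q := q3 l hl
    rw [zero_add] at q
    refine Goes.exec (T := 0) (i := .jumpLt 4 1 (3 + (phases es 3).length + 2)) ?_ hc'
      (Goes.done _ hc' ?_)
    · rw [q1]; exact hP''.get 0 rfl
    · simp only [Instr.exec, q, q2, q1]
      split_ifs with h
      · rw [hP''.get 2 rfl]
        simp [show f l ⟨n - 1, by omega⟩ = 0 by omega]
      · rw [hP''.get 1 rfl]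
        simp [show f l ⟨n - 1, by omega⟩ ≠ 0 by omega]

end RAM

/-! ### Counting pairs by representatives. -/

namespace Finset

variable {V : Type*} [LinearOrder V] [Fintype V]

/-- `w` has a two-element neighbourhood `N w`, which it shares with exactly one smaller vertex. -/
def IsRep (N : V → Finset V) (w : V) : Prop :=
  (N w).card = 2 ∧ ({u | u < w ∧ N u = N w} : Finset V).card = 1

instance (N : V → Finset V) (w : V) : Decidable (IsRep N w) :=
  inferInstanceAs (Decidable (_ ∧ _))

/-- If `w < w'`, then `w` together with the smaller vertex sharing its neighbourhood would give two
such vertices below `w'`. -/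
theorem IsRep.eq {N : V → Finset V} {w w' : V} (h : IsRep N w) (h' : IsRep N w')
    (hw : N w = N w') : w = w' := by
  have key : ∀ {w w' : V}, IsRep N w → IsRep N w' → N w = N w' → ¬ w < w' := by
    intro w w' h h' hw hlt
    have hss : ({u | u < w ∧ N u = N w} : Finset V) ⊂ ({u | u < w' ∧ N u = N w'} : Finset V) := by
      refine (ssubset_iff_of_subset fun u hu => ?_).2 ⟨w, by simp [hlt, hw], by simp⟩
      simp only [mem_filter, mem_univ, true_and] at hu ⊢
      exact ⟨hu.1.trans hlt, hu.2.trans hw⟩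
    have := card_lt_card hss
    rw [h.2, h'.2] at this
    omega
  rcases lt_trichotomy w w' with hlt | rfl | hlt
  · exact (key h h' hw hlt).elim
  · rfl
  · exact (key h' h hw.symm hlt).elim

theorem IsRep.two_le {N : V → Finset V} {w : V} (h : IsRep N w) :
    2 ≤ ({u | N u = N w} : Finset V).card := by
  obtain ⟨u, hu⟩ := card_pos.1 (h.2.symm ▸ Nat.one_pos)
  simp only [mem_filter, mem_univ, true_and] at hu
  exact one_lt_card.2 ⟨u, by simpa using hu.2, w, by simp, hu.1.ne⟩

/-- The representative is the second smallest vertex with neighbourhood `p`. -/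
theorem exists_isRep {N : V → Finset V} {p : Finset V} (hp : p.card = 2)
    (h : 2 ≤ ({u | N u = p} : Finset V).card) : ∃ w, IsRep N w ∧ N w = p := by
  set W : Finset V := {u | N u = p} with hW
  have h₁ : W.Nonempty := card_pos.1 (by omega)
  have h₂ : (W.erase (W.min' h₁)).Nonempty := by
    apply card_pos.1
    rw [card_erase_of_mem (min'_mem _ _)]
    omega
  have hw := min'_mem _ h₂
  set w := (W.erase (W.min' h₁)).min' h₂ with hwdef
  have hwp : N w = p := by simpa [hW] using (mem_erase.1 hw).2
  refine ⟨w, ⟨by rw [hwp, hp], card_eq_one.2 ⟨W.min' h₁, ?_⟩⟩, hwp⟩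
  ext u
  simp only [mem_filter, mem_univ, true_and, mem_singleton, hwp]
  constructor
  · rintro ⟨hu, hup⟩
    by_contra hne
    exact absurd (min'_le (W.erase (W.min' h₁)) u (mem_erase.2 ⟨hne, by simp [hW, hup]⟩))
      (not_le.2 hu)
  · rintro rfl
    refine ⟨lt_of_le_of_ne (min'_le _ _ (mem_erase.1 hw).2) (mem_erase.1 hw).1.symm, ?_⟩
    simpa [hW] using min'_mem W h₁

/-- Every pair in `Q` is the neighbourhood of at least two vertices if and only if the number of
representatives equals the number of pairs. -/
theorem forall_two_le_iff_card_isRep (N : V → Finset V) (Q : Finset V) :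
    (∀ p ∈ powersetCard 2 Q, 2 ≤ ({w | N w = p} : Finset V).card) ↔
      2 * ({w | IsRep N w ∧ N w ⊆ Q} : Finset V).card + Q.card = Q.card * Q.card := by
  set R : Finset V := {w | IsRep N w ∧ N w ⊆ Q} with hR
  have hinj : Set.InjOn N R := by
    intro w hw w' hw' h
    simp only [hR, coe_filter, mem_univ, true_and, Set.mem_ofPred_eq] at hw hw'
    exact hw.1.eq hw'.1 h
  have hsub : R.image N ⊆ powersetCard 2 Q := by
    intro p hp
    obtain ⟨w, hw, rfl⟩ := mem_image.1 hp
    simp only [hR, mem_filter, mem_univ, true_and] at hw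
    exact mem_powersetCard.2 ⟨hw.2, hw.1.1⟩
  have hcount : 2 * (powersetCard 2 Q).card + Q.card = Q.card * Q.card := by
    rw [card_powersetCard, Nat.choose_two_right,
      Nat.mul_div_cancel' (Nat.even_mul_pred_self _).two_dvd]
    cases Q.card with
    | zero => rfl
    | succ k => rw [Nat.add_sub_cancel]; ring
  -- `N` embeds the representatives into the pairs, so the counts agree exactly when every pair is
  -- hit.
  have hiff : R.card = (powersetCard 2 Q).card ↔ R.image N = powersetCard 2 Q := by
    rw [← card_image_of_injOn hinj]
    exact ⟨fun h => eq_of_subset_of_card_le hsub h.ge, fun h => by rw [h]⟩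
  rw [← hcount, Nat.add_right_cancel_iff, Nat.mul_right_inj two_ne_zero, hiff]
  constructor
  · refine fun h => hsub.antisymm fun p hp => ?_
    obtain ⟨w, hw, rfl⟩ := exists_isRep (mem_powersetCard.1 hp).2 (h p hp)
    exact mem_image_of_mem _ (by simp [hR, hw, (mem_powersetCard.1 hp).1])
  · intro h p hp
    obtain ⟨w, hw, rfl⟩ := mem_image.1 (h ▸ hp)
    simp only [hR, mem_filter, mem_univ, true_and] at hw
    exact hw.1.two_le

end Finset

/-! ### Characterisation of the graphs with γ(G) = |A|. -/

namespace SimpleGraph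

open Finset

variable {V : Type*} {G : SimpleGraph V}

theorem dominationNumber_eq_iff [Fintype V] {A : Finset V} (hA : G.IsDominatingSet A) :
    G.dominationNumber = A.card ↔ ∀ D : Finset V, G.IsDominatingSet D → A.card ≤ D.card := by
  constructor
  · intro h D hD
    rw [← h]
    exact Nat.sInf_le ⟨D, hD, rfl⟩
  · intro h
    refine le_antisymm (Nat.sInf_le ⟨A, hA, rfl⟩) (le_csInf ⟨_, A, hA, rfl⟩ ?_)
    rintro _ ⟨D, hD, rfl⟩
    exact h D hD

theorem isDominatingSet_of_isBipartiteWith {A B : Finset V} (hG : G.Connected)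
    (hAB : G.IsBipartiteWith (A : Set V) (B : Set V)) (hA : A.Nonempty) :
    G.IsDominatingSet A := by
  intro v hv
  obtain ⟨a, ha⟩ := hA
  have : Nontrivial V := ⟨v, a, fun h => hv (h ▸ ha)⟩
  obtain ⟨u, hu⟩ := hG.preconnected.exists_adj_of_nontrivial v
  refine ⟨u, ?_, hu⟩
  rcases hAB.mem_of_adj hu with h | h
  · exact (hv (by simpa using h.1)).elim
  · simpa using h.2

variable [Fintype V] [DecidableRel G.Adj]

variable (G) in
/-- The vertices of `A` without a neighbour of degree one. -/
def nonSupport (A : Finset V) : Finset V :=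
  {x ∈ A | ∀ w, G.Adj x w → (G.neighborFinset w).card ≠ 1}

theorem mem_nonSupport {A : Finset V} {x : V} : x ∈ G.nonSupport A ↔
    x ∈ A ∧ ∀ w, G.Adj x w → (G.neighborFinset w).card ≠ 1 :=
  mem_filter.trans Iff.rfl

variable [LinearOrder V]

/-- If two vertices of `A` with a common neighbour are not both adjacent to two private common
neighbours, then `A` is not a smallest dominating set. -/
theorem two_le_card_of_forall_dominating {A B : Finset V}
    (hAB : G.IsBipartiteWith (A : Set V) (B : Set V)) (hU : A ∪ B = univ)
    (hA : G.IsDominatingSet A) (h : ∀ D : Finset V, G.IsDominatingSet D → A.card ≤ D.card)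
    {x y b : V} (hx : x ∈ G.nonSupport A) (hy : y ∈ G.nonSupport A) (hxy : x ≠ y)
    (hbx : G.Adj b x) (hby : G.Adj b y) :
    2 ≤ ({w | G.neighborFinset w = {x, y}} : Finset V).card := by
  by_contra! hlt
  obtain ⟨hxA, hx⟩ := mem_nonSupport.1 hx
  obtain ⟨hyA, hy⟩ := mem_nonSupport.1 hy
  -- `w` is the only vertex with neighbourhood `{x, y}` if there is one, and `b` otherwise.
  obtain ⟨w, hwx, hwy, hw⟩ : ∃ w, G.Adj w x ∧ G.Adj w y ∧
      ∀ u, G.neighborFinset u = {x, y} → u = w := by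
    by_cases he : ∃ w, G.neighborFinset w = {x, y}
    · obtain ⟨w, hw⟩ := he
      refine ⟨w, ?_, ?_, fun u hu => ?_⟩
      · rw [← mem_neighborFinset, hw]; simp
      · rw [← mem_neighborFinset, hw]; simp
      · exact card_le_one.1 (Nat.lt_succ_iff.1 hlt) u (by simpa using hu) w (by simpa using hw)
    · exact ⟨b, hbx, hby, fun u hu => (he ⟨u, hu⟩).elim⟩
  have hD : G.IsDominatingSet (insert w ((A.erase x).erase y)) := by
    intro v hv
    simp only [mem_insert, mem_erase, not_or, not_and, ne_eq] at hv
    by_cases hvx : v = x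
    · exact ⟨w, by simp, hvx ▸ hwx.symm⟩
    by_cases hvy : v = y
    · exact ⟨w, by simp, hvy ▸ hwy.symm⟩
    have hvA : v ∉ A := hv.2 hvy hvx
    -- An undominated `v` has all its neighbours in `{x, y}`. Having just one would contradict that
    -- `x` and `y` lie in the core; having both forces `v = w`.
    by_contra! hno
    have hsub : ∀ u, G.Adj v u → u = x ∨ u = y := by
      intro u hu
      have hvB : v ∈ B := by
        have := mem_univ v
        rw [← hU, mem_union] at this
        exact this.resolve_left hvA
      have huA : u ∈ A := by
        have := hAB.mem_of_adj hu
        rcases this with h | h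
        · exact (hvA (by simpa using h.1)).elim
        · simpa using h.2
      by_contra! hne
      exact hno u (by simp [hne, huA]) hu
    have hvx' : G.Adj v x := by
      by_contra hvx'
      obtain ⟨u, -, hu⟩ := hA v hvA
      have huy : ∀ u, G.Adj v u → u = y := fun u hu => (hsub u hu).resolve_left (by
        rintro rfl; exact hvx' hu)
      have := huy u hu
      subst this
      refine hy v hu.symm (card_eq_one.2 ⟨u, ?_⟩)
      ext z
      simp only [mem_neighborFinset, mem_singleton]
      exact ⟨huy z, fun h => h ▸ hu⟩
    have hvy' : G.Adj v y := by
      by_contra hvy'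
      refine hx v hvx'.symm (card_eq_one.2 ⟨x, ?_⟩)
      ext z
      simp only [mem_neighborFinset, mem_singleton]
      exact ⟨fun hz => (hsub z hz).resolve_right (by rintro rfl; exact hvy' hz), fun h => h ▸ hvx'⟩
    refine hv.1 (hw v ?_)
    ext z
    simp only [mem_neighborFinset, mem_insert, mem_singleton]
    exact ⟨hsub z, by rintro (rfl | rfl) <;> assumption⟩
  have h₁ := h _ hD
  have h₂ := card_insert_le w ((A.erase x).erase y)
  have h₃ : ((A.erase x).erase y).card + 1 = (A.erase x).card :=
    card_erase_add_one (mem_erase.2 ⟨hxy.symm, hyA⟩)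
  have h₄ : (A.erase x).card + 1 = A.card := card_erase_add_one hxA
  omega

/-- With T the part of the core outside D, each x in A \ D is sent to some b in D \ A: a leaf at x
if x is not in the core; a vertex with N(b) = {x, y} if x shares a neighbour with another y in T;
otherwise any neighbour in D. Then |N(b) ∩ T| is 0, 2 or 1 respectively, so the kinds do not
collide. -/
theorem card_le_of_isDominatingSet {A B : Finset V}
    (hAB : G.IsBipartiteWith (A : Set V) (B : Set V))
    (h : ∀ x ∈ G.nonSupport A, ∀ y ∈ G.nonSupport A, x ≠ y → ∀ b, G.Adj b x → G.Adj b y →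
      2 ≤ ({w | G.neighborFinset w = {x, y}} : Finset V).card)
    {D : Finset V} (hD : G.IsDominatingSet D) : A.card ≤ D.card := by
  rcases A.eq_empty_or_nonempty with rfl | ⟨a, -⟩
  · simp
  have hnotA : ∀ {x w}, x ∈ A → G.Adj x w → w ∉ A := fun {x w} hx hw hwA =>
    Set.disjoint_left.1 hAB.disjoint (by simpa using hwA)
      (by simpa using hAB.mem_of_mem_adj (by simpa using hx) hw)
  -- a vertex all of whose neighbours avoid `D` belongs to `D`
  have hmem : ∀ {w}, Disjoint (G.neighborFinset w) D → w ∈ D := by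
    intro w hw
    by_contra hwD
    obtain ⟨u, huD, hu⟩ := hD w hwD
    exact Finset.disjoint_left.1 hw (by simpa using hu) huD
  set T := G.nonSupport A \ D with hT
  -- `p` and `q` depend only on the set `{x, y}`, so `x` and `y` choose between the same two
  -- vertices; `a` is a dummy value.
  have hpair : ∀ s : Finset V, ∃ p q, 2 ≤ ({w | G.neighborFinset w = s} : Finset V).card →
      p ≠ q ∧ G.neighborFinset p = s ∧ G.neighborFinset q = s := by
    intro s
    by_cases hs : 2 ≤ ({w | G.neighborFinset w = s} : Finset V).card
    · obtain ⟨p, hp, q, hq, hpq⟩ := one_lt_card.1 hs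
      exact ⟨p, q, fun _ => ⟨hpq, by simpa using hp, by simpa using hq⟩⟩
    · exact ⟨a, a, fun h => (hs h).elim⟩
  choose p q hpq using hpair
  have hex : ∀ x ∈ A \ D, ∃ b ∈ D \ A,
      (G.neighborFinset b = {x} ∧ x ∉ T) ∨
      (∃ y, x ≠ y ∧ x ∈ T ∧ y ∈ T ∧ G.neighborFinset b = {x, y} ∧
        p {x, y} ≠ q {x, y} ∧ b = if x < y then p {x, y} else q {x, y}) ∨
      G.neighborFinset b ∩ T = {x} := by
    intro x hx
    obtain ⟨hxA, hxD⟩ := mem_sdiff.1 hx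
    by_cases hxT : x ∈ G.nonSupport A
    · have hxT' : x ∈ T := mem_sdiff.2 ⟨hxT, hxD⟩
      by_cases hy : ∃ y ∈ T, x ≠ y ∧ ∃ b, G.Adj b x ∧ G.Adj b y
      · obtain ⟨y, hyT, hxy, b, hbx, hby⟩ := hy
        obtain ⟨hyT₁, hyD⟩ := mem_sdiff.1 hyT
        obtain ⟨hne, hp, hq⟩ := hpq _ (h x hxT y hyT₁ hxy b hbx hby)
        have hN : G.neighborFinset (if x < y then p {x, y} else q {x, y}) = {x, y} := by
          have key : ∀ c, c = (if x < y then p {x, y} else q {x, y}) →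
              G.neighborFinset c = {x, y} := by
            intro c hc
            split_ifs at hc <;> subst hc <;> assumption
          exact key _ rfl
        refine ⟨if x < y then p {x, y} else q {x, y}, mem_sdiff.2 ⟨hmem ?_, hnotA hxA ?_⟩,
          Or.inr (Or.inl ⟨y, hxy, hxT', hyT, hN, hne, rfl⟩)⟩
        · rw [hN]; simp [hxD, hyD]
        · rw [G.adj_comm, ← mem_neighborFinset, hN]; simp
      · obtain ⟨b, hbD, hb⟩ := hD x hxD
        refine ⟨b, mem_sdiff.2 ⟨hbD, hnotA hxA hb⟩, Or.inr (Or.inr ?_)⟩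
        ext y
        simp only [mem_inter, mem_neighborFinset, mem_singleton]
        refine ⟨fun ⟨h₁, h₂⟩ => ?_, fun h => h ▸ ⟨hb.symm, hxT'⟩⟩
        by_contra hne
        exact hy ⟨y, h₂, Ne.symm hne, b, hb.symm, h₁⟩
    · have : ∃ w, G.Adj x w ∧ (G.neighborFinset w).card = 1 := by
        by_contra! hno
        exact hxT (mem_nonSupport.2 ⟨hxA, hno⟩)
      obtain ⟨w, hw, hw1⟩ := this
      obtain ⟨z, hz⟩ := card_eq_one.1 hw1
      have : x ∈ G.neighborFinset w := by simpa using hw.symm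
      obtain rfl : x = z := by simpa [hz] using this
      exact ⟨w, mem_sdiff.2 ⟨hmem (by simp [hz, hxD]), hnotA hxA hw⟩,
        Or.inl ⟨hz, fun h => hxT (mem_sdiff.1 h).1⟩⟩
  have hpairT : ∀ {x y b : V}, x ≠ y → x ∈ T → y ∈ T → G.neighborFinset b = {x, y} →
      ∀ z, G.neighborFinset b ∩ T ≠ {z} := by
    intro x y b hxy hx hy hN z hz
    have h₁ : x ∈ G.neighborFinset b ∩ T := by simp [hN, hx]
    have h₂ : y ∈ G.neighborFinset b ∩ T := by simp [hN, hy]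
    rw [hz, mem_singleton] at h₁ h₂
    exact hxy (h₁.trans h₂.symm)
  have hcard : (A \ D).card ≤ (D \ A).card := by
    choose! f hf hf' using hex
    refine card_le_card_of_injOn f hf fun x hx x' hx' hxx => ?_
    have k := hf' x hx
    have k' := hf' x' hx'
    rw [← hxx] at k'
    generalize f x = b at k k'
    rcases k with ⟨hN, hxT⟩ | ⟨y, hxy, hxT, hyT, hN, hne, hb⟩ | hN
    · rcases k' with ⟨hN', hxT'⟩ | ⟨y', hxy', hxT', hyT', hN', hne', hb'⟩ | hN'
      · exact singleton_injective (hN.symm.trans hN')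
      · have h₁ : x' ∈ G.neighborFinset b := by simp [hN']
        have h₂ : y' ∈ G.neighborFinset b := by simp [hN']
        rw [hN, mem_singleton] at h₁ h₂
        exact (hxy' (h₁.trans h₂.symm)).elim
      · rw [hN, singleton_inter_of_notMem hxT] at hN'
        exact (singleton_ne_empty _ hN'.symm).elim
    · rcases k' with ⟨hN', hxT'⟩ | ⟨y', hxy', hxT', hyT', hN', hne', hb'⟩ | hN'
      · have h₁ : x ∈ G.neighborFinset b := by simp [hN]
        have h₂ : y ∈ G.neighborFinset b := by simp [hN]
        rw [hN', mem_singleton] at h₁ h₂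
        exact (hxy (h₁.trans h₂.symm)).elim
      · have hs : ({x, y} : Finset V) = {x', y'} := hN.symm.trans hN'
        have h₁ : x' = x ∨ x' = y := by
          have : x' ∈ ({x, y} : Finset V) := by simp [hs]
          simpa using this
        have h₂ : y' = x ∨ y' = y := by
          have : y' ∈ ({x, y} : Finset V) := by simp [hs]
          simpa using this
        rcases h₁ with rfl | rfl
        · rfl
        -- Two vertices using the same pair from opposite sides: the comparison gives one `p` and
        -- the other `q`.
        · obtain rfl : y' = x := h₂.resolve_right (Ne.symm hxy')
          rw [← hs, hb] at hb'
          rcases lt_or_gt_of_ne hxy with hlt | hlt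
          · rw [if_pos hlt, if_neg hlt.not_gt] at hb'
            exact (hne hb').elim
          · rw [if_neg hlt.not_gt, if_pos hlt] at hb'
            exact (hne hb'.symm).elim
      · exact (hpairT hxy hxT hyT hN _ hN').elim
    · rcases k' with ⟨hN', hxT'⟩ | ⟨y', hxy', hxT', hyT', hN', hne', hb'⟩ | hN'
      · rw [hN', singleton_inter_of_notMem hxT'] at hN
        exact (singleton_ne_empty _ hN.symm).elim
      · exact (hpairT hxy' hxT' hyT' hN' _ hN).elim
      · exact singleton_injective (hN.symm.trans hN')
  have h₁ := card_sdiff_add_card_inter A D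
  have h₂ := card_sdiff_add_card_inter D A
  rw [inter_comm] at h₂
  omega

/-- Bipartite graphs whose domination number is the size of a partite set. -/
theorem dominationNumber_eq_card_iff {A B : Finset V} (hG : G.Connected)
    (hAB : G.IsBipartiteWith (A : Set V) (B : Set V)) (hU : A ∪ B = univ) (hA : A.Nonempty) :
    G.dominationNumber = A.card ↔ ∀ b, ∀ s ∈ powersetCard 2 (G.neighborFinset b ∩ G.nonSupport A),
      2 ≤ ({w | G.neighborFinset w = s} : Finset V).card := by
  have hdom := isDominatingSet_of_isBipartiteWith hG hAB hA
  rw [dominationNumber_eq_iff hdom]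
  constructor
  · intro h b s hs
    obtain ⟨hs, hs2⟩ := mem_powersetCard.1 hs
    obtain ⟨x, y, hxy, rfl⟩ := card_eq_two.1 hs2
    have hx := mem_inter.1 (hs (mem_insert_self x {y}))
    have hy := mem_inter.1 (hs (mem_insert_of_mem (mem_singleton_self y)))
    exact two_le_card_of_forall_dominating hAB hU hdom h hx.2 hy.2 hxy (by simpa using hx.1)
      (by simpa using hy.1)
  · intro h D hD
    refine card_le_of_isDominatingSet hAB (fun x hx y hy hxy b hbx hby => ?_) hD
    refine h b _ (mem_powersetCard.2 ⟨?_, card_pair hxy⟩)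
    simp [insert_subset_iff, hx, hy, hbx, hby]

end SimpleGraph

namespace RAM

open Finset

/-! ### The algorithm -/

namespace Expr

/-- `1` if `x = y`, and `0` otherwise. -/
def eq (x y : Expr) : Expr := sub (const 1) (add (sub x y) (sub y x))

/-- `1` if `x < y`, and `0` otherwise. -/
def lt (x y : Expr) : Expr := sub (const 1) (sub (add x (const 1)) y)

/-- The entry of the adjacency matrix in row `x` and column `y`. -/
def adj (x y : Expr) : Expr := load (add (add size (mul x size)) y)

/-- The entry with index `x` in the array number `k`. -/
def entry (k : ℕ) (x : Expr) : Expr :=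
  load (add (add (add size (mul size size)) (mul (const k) size)) x)

/-- `1` if `x` belongs to `A` and has no neighbour of degree one, and `0` otherwise. -/
def inCore (x : Expr) : Expr := mul (load x) (eq (entry 4 x) (const 0))

/-- `1` if `x` has degree two and shares its neighbourhood with exactly one smaller vertex, and
`0` otherwise. -/
def isRep (x : Expr) : Expr := mul (eq (entry 0 x) (const 2)) (eq (entry 5 x) (const 1))

/-- `2 * (entry 7 x) + entry 6 x` -/
def pairCount (x : Expr) : Expr := add (mul (const 2) (entry 7 x)) (entry 6 x)

/-- The square of `entry 6 x`. -/
def square (x : Expr) : Expr := mul (entry 6 x) (entry 6 x)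

variable {n v w : ℕ} {m : ℕ → ℕ}

theorem eval_eq (x y : Expr) :
    (eq x y).eval n v w m = if x.eval n v w m = y.eval n v w m then 1 else 0 := by
  simp only [eq, eval]
  split_ifs <;> omega

theorem eval_lt (x y : Expr) :
    (lt x y).eval n v w m = if x.eval n v w m < y.eval n v w m then 1 else 0 := by
  simp only [lt, eval]
  split_ifs <;> omega

end Expr

open RAM.Expr in
/-- The entries of the arrays that the algorithm computes, in terms of the row index `v`: the degree
of `v`; the sum of its neighbours; its smaller and its larger neighbour if it has degree two; the
number of its neighbours of degree one; the number of smaller vertices of degree two with the same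
neighbours; the number of its neighbours in the core; the number of representatives of pairs of
such neighbours; and the total deviation from the equality of the numbers of pairs and of
representatives. -/
def algorithm : List Expr :=
  [adj row col,
    mul col (adj row col),
    -- If the neighbours are x < y, with sum s = x + y, then 2x < s < 2y tells them apart.
    mul (mul col (adj row col))
      (mul (lt (mul (const 2) col) (entry 1 row)) (eq (entry 0 row) (const 2))),
    mul (mul col (adj row col))
      (mul (lt (entry 1 row) (mul (const 2) col)) (eq (entry 0 row) (const 2))),
    mul (adj row col) (eq (entry 0 col) (const 1)),
    mul (mul (lt col row) (eq (entry 0 col) (const 2)))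
      (mul (eq (entry 2 col) (entry 2 row)) (eq (entry 3 col) (entry 3 row))),
    mul (adj row col) (inCore col),
    -- The inclusion of the neighbourhood of the column vertex is tested by looking up its two
    -- stored neighbours.
    mul (isRep col) (mul (mul (adj row (entry 2 col)) (inCore (entry 2 col)))
      (mul (adj row (entry 3 col)) (inCore (entry 3 col)))),
    add (sub (pairCount col) (square col)) (sub (square col) (pairCount col))]

theorem inputConfig_mem_le {n : ℕ} {G : SimpleGraph (Fin n)} {A : Finset (Fin n)} (i : ℕ) :
    (inputConfig G A).mem i ≤ 1 := by
  simp only [inputConfig]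
  split_ifs <;> omega

theorem inputConfig_mem_vertex {n : ℕ} {G : SimpleGraph (Fin n)} {A : Finset (Fin n)}
    (v : Fin n) :
    (inputConfig G A).mem v = if v ∈ A then 1 else 0 := by
  by_cases hv : v ∈ A
  · rw [if_pos hv]
    exact if_pos (Or.inl ⟨v, hv, rfl⟩)
  rw [if_neg hv]
  refine if_neg fun h => hv ?_
  revert h
  rintro (⟨i, hi, h⟩ | ⟨i, j, -, h⟩)
  · rwa [Fin.ext h]
  · have := v.2
    omega

/-! ### Intended contents of the arrays. -/

variable {n : ℕ} (G : SimpleGraph (Fin n)) [DecidableRel G.Adj] (A : Finset (Fin n))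

/-- The sum of the neighbours of `v`. -/
def neighborSum (v : Fin n) : ℕ := ∑ w ∈ G.neighborFinset v, (w : ℕ)

/-- The smaller neighbour of a vertex of degree two. -/
def smallNeighbor (v : Fin n) : ℕ :=
  ∑ w ∈ G.neighborFinset v,
    if 2 * (w : ℕ) < neighborSum G v ∧ (G.neighborFinset v).card = 2 then (w : ℕ) else 0

/-- The larger neighbour of a vertex of degree two. -/
def largeNeighbor (v : Fin n) : ℕ :=
  ∑ w ∈ G.neighborFinset v,
    if neighborSum G v < 2 * (w : ℕ) ∧ (G.neighborFinset v).card = 2 then (w : ℕ) else 0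

/-- The number of neighbours of `v` in the core of `A`. -/
def coreDegree (v : Fin n) : ℕ := (G.neighborFinset v ∩ G.nonSupport A).card

/-- The number of representatives of pairs of neighbours of `v` in the core of `A`. -/
def repCount (v : Fin n) : ℕ :=
  ({w | IsRep (fun w => G.neighborFinset w) w ∧
    G.neighborFinset w ⊆ G.neighborFinset v ∩ G.nonSupport A} : Finset (Fin n)).card

/-- The intended entries of the arrays. -/
def arrays : ℕ → Fin n → ℕ
  | 0, v => (G.neighborFinset v).card
  | 1, v => neighborSum G v
  | 2, v => smallNeighbor G v
  | 3, v => largeNeighbor G v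
  | 4, v => ({w ∈ G.neighborFinset v | (G.neighborFinset w).card = 1} : Finset (Fin n)).card
  | 5, v => ({u | u < v ∧ (G.neighborFinset u).card = 2 ∧ smallNeighbor G u = smallNeighbor G v ∧
      largeNeighbor G u = largeNeighbor G v} : Finset (Fin n)).card
  | 6, v => coreDegree G A v
  | 7, v => repCount G A v
  -- Opposite truncated differences add up to an absolute difference. The array is constant, so its
  -- last entry decides.
  | 8, _ => ∑ w : Fin n, ((2 * repCount G A w + coreDegree G A w -
      coreDegree G A w * coreDegree G A w) + (coreDegree G A w * coreDegree G A w -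
      (2 * repCount G A w + coreDegree G A w)))
  | _, _ => 0

variable {G A}

theorem neighbors_of_pair {v x y : Fin n} (hxy : x < y) (h : G.neighborFinset v = {x, y}) :
    smallNeighbor G v = x ∧ largeNeighbor G v = y := by
  have hlt : (x : ℕ) < y := hxy
  have hs : neighborSum G v = x + y := by rw [neighborSum, h, sum_pair hxy.ne]
  have hc : (G.neighborFinset v).card = 2 := by rw [h, card_pair hxy.ne]
  constructor
  · rw [smallNeighbor, hs, hc, h, sum_pair hxy.ne, if_pos (by omega), if_neg (by omega), add_zero]
  · rw [largeNeighbor, hs, hc, h, sum_pair hxy.ne, if_neg (by omega), if_pos (by omega), zero_add]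

theorem neighbors_of_card_ne {v : Fin n} (h : (G.neighborFinset v).card ≠ 2) :
    smallNeighbor G v = 0 ∧ largeNeighbor G v = 0 := by
  constructor <;> exact sum_eq_zero fun w _ => if_neg fun h' => h h'.2

theorem exists_pair {v : Fin n} (h : (G.neighborFinset v).card = 2) :
    ∃ x y, x < y ∧ G.neighborFinset v = {x, y} := by
  obtain ⟨x, y, hxy, h⟩ := card_eq_two.1 h
  rcases lt_or_gt_of_ne hxy with hlt | hlt
  · exact ⟨x, y, hlt, h⟩
  · exact ⟨y, x, hlt, by rw [h, pair_comm]⟩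

/-- For degrees other than two the stored value 0 is still a vertex, so lookups at these indices
stay inside the adjacency matrix and the arrays. -/
theorem exists_neighbors_eq (v : Fin n) :
    ∃ x y : Fin n, smallNeighbor G v = x ∧ largeNeighbor G v = y ∧
      ((G.neighborFinset v).card = 2 → G.neighborFinset v = {x, y}) := by
  by_cases h : (G.neighborFinset v).card = 2
  · obtain ⟨x, y, hxy, hN⟩ := exists_pair h
    exact ⟨x, y, (neighbors_of_pair hxy hN).1, (neighbors_of_pair hxy hN).2, fun _ => hN⟩
  · have hv := v.2
    exact ⟨⟨0, by omega⟩, ⟨0, by omega⟩, (neighbors_of_card_ne h).1, (neighbors_of_card_ne h).2,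
      fun h' => (h h').elim⟩

/-- This replaces the comparison of two rows of the matrix by a constant number of comparisons. -/
theorem neighborFinset_eq_iff {u v : Fin n} (hv : (G.neighborFinset v).card = 2) :
    ((G.neighborFinset u).card = 2 ∧ smallNeighbor G u = smallNeighbor G v ∧
      largeNeighbor G u = largeNeighbor G v) ↔ G.neighborFinset u = G.neighborFinset v := by
  obtain ⟨x, y, hxy, h⟩ := exists_pair hv
  constructor
  · rintro ⟨hu, hs, hl⟩
    obtain ⟨x', y', hxy', h'⟩ := exists_pair hu
    rw [(neighbors_of_pair hxy h).1, (neighbors_of_pair hxy' h').1] at hs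
    rw [(neighbors_of_pair hxy h).2, (neighbors_of_pair hxy' h').2] at hl
    rw [h, h', Fin.ext hs, Fin.ext hl]
  · intro hu
    have h' := hu.trans h
    refine ⟨hu ▸ hv, ?_, ?_⟩
    · rw [(neighbors_of_pair hxy h).1, (neighbors_of_pair hxy h').1]
    · rw [(neighbors_of_pair hxy h).2, (neighbors_of_pair hxy h').2]

theorem isRep_iff (v : Fin n) : IsRep (fun w => G.neighborFinset w) v ↔
    arrays G A 0 v = 2 ∧ arrays G A 5 v = 1 := by
  refine and_congr_right fun hv => ?_
  simp only [arrays, neighborFinset_eq_iff hv]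

/-- The exponent comes from array `8`: a sum of n deviations, each at most 2n² ≤ n³. -/
theorem arrays_le (hn : 2 ≤ n) (k : ℕ) (v : Fin n) : arrays G A k v ≤ n ^ 4 := by
  have h₁ : n ≤ n ^ 4 := Nat.le_self_pow (by norm_num) n
  have hcard : ∀ s : Finset (Fin n), s.card ≤ n := fun s => by simpa using card_le_univ s
  have hcard' : ∀ s : Finset (Fin n), s.card ≤ n ^ 4 := fun s => (hcard s).trans h₁
  have hsum : ∀ (s : Finset (Fin n)) (f : Fin n → ℕ), (∀ w, f w ≤ n ^ 3) →
      ∑ w ∈ s, f w ≤ n ^ 4 := fun s f hf =>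
    calc ∑ w ∈ s, f w ≤ s.card * n ^ 3 := sum_le_card_nsmul _ _ _ fun w _ => hf w
      _ ≤ n * n ^ 3 := Nat.mul_le_mul_right _ (hcard s)
      _ = n ^ 4 := by ring
  have hw : ∀ w : Fin n, (w : ℕ) ≤ n ^ 3 := fun w => w.2.le.trans (Nat.le_self_pow (by norm_num) n)
  match k with
  | 0 => exact hcard' _
  | 1 => exact hsum (G.neighborFinset v) _ hw
  | 2 =>
    rw [arrays, smallNeighbor]
    refine hsum _ _ fun w => ?_
    split_ifs
    exacts [hw w, Nat.zero_le _]
  | 3 =>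
    rw [arrays, largeNeighbor]
    refine hsum _ _ fun w => ?_
    split_ifs
    exacts [hw w, Nat.zero_le _]
  | 4 => exact hcard' _
  | 5 => exact hcard' _
  | 6 => exact hcard' (G.neighborFinset v ∩ G.nonSupport A)
  | 7 => exact (hcard _ : repCount G A v ≤ n).trans h₁
  | 8 =>
    refine hsum _ _ fun w => ?_
    have hc : coreDegree G A w ≤ n := hcard _
    have hr : repCount G A w ≤ n := hcard _
    have hcc : coreDegree G A w * coreDegree G A w ≤ n * n := Nat.mul_le_mul hc hc
    have h₂ : 2 * n ≤ n * n := Nat.mul_le_mul_right n hn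
    have h₃ : 2 * (n * n) ≤ n ^ 3 := by
      rw [pow_succ, pow_two, mul_comm]
      exact Nat.mul_le_mul_left _ hn
    omega
  | _ + 9 => exact Nat.zero_le _

theorem inputConfig_mem_adj (v w : Fin n) :
    (inputConfig G A).mem (n + v * n + w) = if G.Adj v w then 1 else 0 := by
  by_cases hv : G.Adj v w
  · rw [if_pos hv]
    exact if_pos (Or.inr ⟨v, w, hv, rfl⟩)
  rw [if_neg hv]
  refine if_neg fun h => hv ?_
  revert h
  rintro (⟨i, -, h⟩ | ⟨i, j, hij, h⟩)
  · have := i.2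
    omega
  · have hn : 0 < n := v.pos
    -- Division by `n` with remainder recovers row and column from the address.
    have h' : n * (v : ℕ) + w = n * (i : ℕ) + j := by rw [mul_comm n, mul_comm n]; omega
    have hd := congrArg (· / n) h'
    have hm := congrArg (· % n) h'
    simp only [Nat.mul_add_div hn, Nat.div_eq_of_lt w.2,
      Nat.div_eq_of_lt j.2, add_zero, Nat.mul_add_mod, Nat.mod_eq_of_lt w.2,
      Nat.mod_eq_of_lt j.2] at hd hm
    rwa [Fin.ext hd, Fin.ext hm]

/-! ### Values of the expressions on a partly filled memory. -/

section Eval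

variable {m : ℕ → ℕ} {k a b : ℕ}

theorem Filled.eval_load (h : Filled n (inputConfig G A).mem (arrays G A) k m) {x : Expr}
    {v : Fin n} (hx : x.eval n a b m = v) :
    (Expr.load x).eval n a b m = if v ∈ A then 1 else 0 := by
  rw [Expr.eval, hx, h.1 _ (by have := v.2; omega), inputConfig_mem_vertex]

theorem Filled.eval_adj (h : Filled n (inputConfig G A).mem (arrays G A) k m) {x y : Expr}
    {v w : Fin n} (hx : x.eval n a b m = v) (hy : y.eval n a b m = w) :
    (Expr.adj x y).eval n a b m = if G.Adj v w then 1 else 0 := by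
  have hlt : n + (v : ℕ) * n + w < n + n * n := by
    have : ((v : ℕ) + 1) * n ≤ n * n := Nat.mul_le_mul_right n v.2
    rw [Nat.succ_mul] at this
    have := w.2
    omega
  simp only [Expr.adj, Expr.eval, hx, hy]
  rw [h.1 _ hlt, inputConfig_mem_adj]

theorem Filled.eval_entry (h : Filled n (inputConfig G A).mem (arrays G A) k m) {x : Expr}
    {v : Fin n} {j : ℕ} (hj : j < k) (hx : x.eval n a b m = v) :
    (Expr.entry j x).eval n a b m = arrays G A j v := by
  simp only [Expr.entry, Expr.eval, hx]
  exact h.2 j hj v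

theorem Filled.eval_inCore (h : Filled n (inputConfig G A).mem (arrays G A) k m) {x : Expr}
    {v : Fin n} (hk : 4 < k) (hx : x.eval n a b m = v) :
    (Expr.inCore x).eval n a b m = if v ∈ G.nonSupport A then 1 else 0 := by
  rw [Expr.inCore, Expr.eval, h.eval_load hx, Expr.eval_eq, h.eval_entry hk hx, ite_mul, one_mul,
    zero_mul, ← ite_and]
  refine if_congr ?_ rfl rfl
  rw [SimpleGraph.mem_nonSupport]
  refine and_congr_right fun _ => ?_
  rw [Expr.eval, arrays, card_eq_zero, filter_eq_empty_iff]
  simp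

theorem Filled.eval_isRep (h : Filled n (inputConfig G A).mem (arrays G A) k m) {x : Expr}
    {v : Fin n} (hk : 5 < k) (hx : x.eval n a b m = v) :
    (Expr.isRep x).eval n a b m = if IsRep (fun w => G.neighborFinset w) v then 1 else 0 := by
  rw [Expr.isRep, Expr.eval, Expr.eval_eq, Expr.eval_eq, h.eval_entry (by omega) hx,
    h.eval_entry hk hx, ite_mul, one_mul, zero_mul, ← ite_and]
  exact if_congr (isRep_iff v).symm rfl rfl

end Eval

theorem sum_eval_algorithm (j : ℕ) (hj : j < algorithm.length) (m : ℕ → ℕ)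
    (h : Filled n (inputConfig G A).mem (arrays G A) j m) (v : Fin n) :
    ∑ w : Fin n, algorithm[j].eval n v w m = arrays G A j v := by
  have hadj : ∀ w : Fin n, (Expr.adj .row .col).eval n v w m = if G.Adj v w then 1 else 0 :=
    fun w => h.eval_adj rfl rfl
  have hrow : ∀ (i : ℕ) (w : Fin n), i < j → (Expr.entry i .row).eval n v w m = arrays G A i v :=
    fun i w hi => h.eval_entry hi rfl
  have hcol : ∀ (i : ℕ) (w : Fin n), i < j → (Expr.entry i .col).eval n v w m = arrays G A i w :=
    fun i w hi => h.eval_entry hi rfl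
  have hN : G.neighborFinset v = univ.filter fun w => G.Adj v w := by ext; simp
  match j, hj with
  | 0, _ =>
    change ∑ w : Fin n, (Expr.adj .row .col).eval n v w m = (G.neighborFinset v).card
    simp only [hadj, hN, card_filter]
  | 1, _ =>
    change ∑ w : Fin n, (w : ℕ) * (Expr.adj .row .col).eval n v w m = neighborSum G v
    simp only [hadj, neighborSum, hN, sum_filter, mul_ite, mul_one, mul_zero]
  | 2, _ =>
    change ∑ w : Fin n, (w : ℕ) * (Expr.adj .row .col).eval n v w m *
      ((Expr.lt _ _).eval n v w m * (Expr.eq _ _).eval n v w m) = smallNeighbor G v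
    simp only [smallNeighbor]
    rw [hN, sum_filter]
    refine sum_congr rfl fun w _ => ?_
    rw [hadj, Expr.eval_lt, Expr.eval_eq, hrow 1 w (by omega), hrow 0 w (by omega)]
    simp only [Expr.eval, arrays, ← hN]
    split_ifs <;> simp_all
  | 3, _ =>
    change ∑ w : Fin n, (w : ℕ) * (Expr.adj .row .col).eval n v w m *
      ((Expr.lt _ _).eval n v w m * (Expr.eq _ _).eval n v w m) = largeNeighbor G v
    simp only [largeNeighbor]
    rw [hN, sum_filter]
    refine sum_congr rfl fun w _ => ?_
    rw [hadj, Expr.eval_lt, Expr.eval_eq, hrow 1 w (by omega), hrow 0 w (by omega)]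
    simp only [Expr.eval, arrays, ← hN]
    split_ifs <;> simp_all
  | 4, _ =>
    change ∑ w : Fin n, (Expr.adj .row .col).eval n v w m * (Expr.eq _ _).eval n v w m =
      Finset.card _
    rw [hN, filter_filter, card_filter]
    refine sum_congr rfl fun w _ => ?_
    rw [hadj, Expr.eval_eq, hcol 0 w (by omega), ite_mul, one_mul, zero_mul, ← ite_and]
    rfl
  | 5, _ =>
    change ∑ w : Fin n, ((Expr.lt _ _).eval n v w m * (Expr.eq _ _).eval n v w m) *
      ((Expr.eq _ _).eval n v w m * (Expr.eq _ _).eval n v w m) = Finset.card _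
    rw [card_filter]
    refine sum_congr rfl fun w _ => ?_
    rw [Expr.eval_lt, Expr.eval_eq, Expr.eval_eq, Expr.eval_eq, hcol 0 w (by omega),
      hcol 2 w (by omega), hcol 3 w (by omega), hrow 2 w (by omega), hrow 3 w (by omega)]
    simp only [ite_mul, one_mul, zero_mul, ← ite_and, and_assoc]
    rfl
  | 6, _ =>
    change ∑ w : Fin n, (Expr.adj .row .col).eval n v w m * (Expr.inCore .col).eval n v w m =
      coreDegree G A v
    rw [coreDegree, hN, ← filter_mem_eq_inter, filter_filter, card_filter]
    refine sum_congr rfl fun w _ => ?_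
    rw [hadj, h.eval_inCore (v := w) (by omega) rfl, ite_mul, one_mul, zero_mul, ← ite_and]
  | 7, _ =>
    change ∑ w : Fin n, (Expr.isRep .col).eval n v w m *
      ((Expr.adj .row _).eval n v w m * (Expr.inCore _).eval n v w m *
      ((Expr.adj .row _).eval n v w m * (Expr.inCore _).eval n v w m)) = repCount G A v
    rw [repCount, card_filter]
    refine sum_congr rfl fun w _ => ?_
    obtain ⟨x, y, hx, hy, hxy⟩ := exists_neighbors_eq (G := G) w
    have ex : (Expr.entry 2 .col).eval n v w m = x := (hcol 2 w (by omega)).trans hx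
    have ey : (Expr.entry 3 .col).eval n v w m = y := (hcol 3 w (by omega)).trans hy
    rw [h.eval_isRep (v := w) (by omega) rfl, h.eval_adj (v := v) rfl ex,
      h.eval_adj (v := v) rfl ey, h.eval_inCore (by omega) ex, h.eval_inCore (by omega) ey]
    simp only [ite_mul, one_mul, zero_mul, ← ite_and]
    -- `x` and `y` need to be the neighbours of `w` only for a representative; otherwise the first
    -- factor is 0.
    refine if_congr (and_congr_right fun hw => ?_) rfl rfl
    rw [hxy hw.1]
    simp [insert_subset_iff, and_assoc]
  | 8, _ =>
    refine sum_congr rfl fun w _ => ?_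
    change (((2 * (Expr.entry 7 .col).eval n v w m + (Expr.entry 6 .col).eval n v w m) -
      (Expr.entry 6 .col).eval n v w m * (Expr.entry 6 .col).eval n v w m) +
      ((Expr.entry 6 .col).eval n v w m * (Expr.entry 6 .col).eval n v w m -
      (2 * (Expr.entry 7 .col).eval n v w m + (Expr.entry 6 .col).eval n v w m))) = _
    rw [hcol 7 w (by omega), hcol 6 w (by omega)]
    rfl
  | j + 9, hj => simp [algorithm] at hj

theorem arrays_eight_eq_zero_iff (v : Fin n) : arrays G A 8 v = 0 ↔
    ∀ b, 2 * repCount G A b + coreDegree G A b = coreDegree G A b * coreDegree G A b := by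
  simp only [arrays, sum_eq_zero_iff, mem_univ, true_implies]
  exact forall_congr' fun b => by omega

end RAM

theorem mainTheorem5 :
    ∃ (P : RAM.Program) (C k : ℕ),
      ∀ (n : ℕ) (G : SimpleGraph (Fin n)) (A B : Finset (Fin n)),
        G.Connected →
        G.IsBipartiteWith (A : Set (Fin n)) (B : Set (Fin n)) →
        A ∪ B = Finset.univ →
        1 ≤ A.card →
        A.card ≤ B.card →
        (∃ b : Bool, RAM.HaltsWithin P (RAM.inputConfig G A) (C * n ^ 2) b ∧
          (b = true ↔ G.dominationNumber = A.card)) ∧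
        RAM.ValuesBoundedBy P (RAM.inputConfig G A) (n ^ k) := by
  refine ⟨RAM.program RAM.algorithm, (RAM.phases RAM.algorithm 3).length + 4,
    RAM.totalExponent 4 RAM.algorithm, fun n G A B hG hAB hU hA hle => ?_⟩
  classical
  -- Both partite sets are nonempty. This excludes `n ≤ 1`, where powers of `n` could not bound the
  -- constants of the program.
  have hn : 2 ≤ n := by
    have hdis : Disjoint A B := by exact_mod_cast hAB.disjoint
    have := Finset.card_union_of_disjoint hdis
    rw [hU, Finset.card_univ, Fintype.card_fin] at this
    omega
  obtain ⟨h, hb⟩ := RAM.program_spec (f := RAM.arrays G A) (c := RAM.inputConfig G A) hn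
    RAM.algorithm 8 rfl RAM.sum_eval_algorithm (RAM.arrays_le hn) RAM.inputConfig_mem_le rfl
    (fun _ => rfl) rfl
  refine ⟨⟨_, h, ?_⟩, hb⟩
  rw [decide_eq_true_iff, RAM.arrays_eight_eq_zero_iff,
    SimpleGraph.dominationNumber_eq_card_iff hG hAB hU (Finset.card_pos.1 hA)]
  exact forall_congr' fun b => (Finset.forall_two_le_iff_card_isRep _ _).symm
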